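/- **Theorem.** Consider finite unweighted graphs $G=(V,E)$ with $n=|V|\ge 1$ vertices, directed or undirected (an undirected graph being regarded as a symmetric directed one); the degree of a vertex is its number of outgoing edges, $\Delta$ is the maximum degree, and $d(u,v)\in\mathbb{N}\cup\{\infty\}$ is the minimum number of (directed) edge hops from $u$ to $v$, with $d(u,v)=\infty$ if $v$ is not reachable from $u$. The model is the word RAM with words of $\Omega(\log n)$ bits (it suffices that $2^w\ge C(n+1)$ for the word length $w$ and a constant $C$), constant-time addition, subtraction and comparison, a read-only input given by adjacency lists with constant-time access to $n$, to the degree of each vertex and to each list entry, and constant-time reservation of uninitialized memory with arbitrary initial contents. Lazy-initialized memory of $k$ cells (in which written and unwritten cells can be told apart) is realized on uninitialized memory by $k$ pointers, $k$ auxiliary pairs (back pointer, value) and one counter of the pairs in use; a cell counts as written if its pointer leads to a pair in use that points back to it. An enumeration algorithm has delay $O(f)$ if the time to the first output, the time between consecutive outputs, and the time from the last output to the detection that there is no further output are all $O(f)$; no preprocessing is allowed. 1. Unweighted single source shortest distance (SSSD) enumeration, i.e., given $G$ and $s\in V$, listing each triple $(s,t,d(s,t))$, $t\in V$, exactly once,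 can be solved with delay in $O(\Delta)$, using $\Theta(n)$ cells of lazy-initialized memory and space in $\Theta(n)$ words in total. 2. The same holds for unweighted row-wise all pairs shortest distance (APSD) enumeration, i.e., given $G$, listing each triple $(u,v,d(u,v))$, $u,v\in V$, exactly once, sorted by the source vertex $u$. Here each algorithm is one fixed program, and the constants depend on nothing else; the delay bound $O(\Delta)$ is read as $O(1)$ when $\Delta=0$, i.e., as $C\cdot\max(\Delta,1)$. -/

import Mathlib

/-! ### Directed unweighted graphs

An undirected graph is the special case of a symmetric adjacency relation. -/

namespace Digraph

variable {V : Type*}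

/-- `G.HopWalk k u v`: there is a walk of exactly `k` directed edges from `u` to `v`. -/
inductive HopWalk (G : Digraph V) : ℕ → V → V → Prop
  | nil (v : V) : HopWalk G 0 v v
  | cons {k : ℕ} {u v x : V} (h : G.Adj u v) (p : HopWalk G k v x) : HopWalk G (k + 1) u x

/-- Shortest distance: the least number of edge hops from `u` to `v`, and `⊤` (infinity) when `v`
is not reachable from `u`. -/
noncomputable def hopDist (G : Digraph V) (u v : V) : ℕ∞ :=
  ⨅ (k : ℕ) (_ : G.HopWalk k u v), (k : ℕ∞)

/-- The degree of a vertex is its number of outgoing edges. -/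
noncomputable def outDeg (G : Digraph V) (v : V) : ℕ := {u : V | G.Adj v u}.ncard

/-- The maximum degree. -/
noncomputable def maxOutDeg [Fintype V] (G : Digraph V) : ℕ := Finset.univ.sup G.outDeg

/-- `L` is an encoding of `G` by adjacency lists: `L v` lists every out-neighbour of `v` exactly
once, in any order. -/
def IsAdjLists {n : ℕ} (G : Digraph (Fin n)) (L : Fin n → List (Fin n)) : Prop :=
  ∀ v, (L v).Nodup ∧ ∀ u, u ∈ L v ↔ G.Adj v u

end Digraph

/-! ### The word RAM

A program is a finite list of instructions. Its registers are named by fixed numbers, so that a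
program only has constantly many of them. Each instruction takes one unit of time. -/

namespace WordRAM

/-- The instructions. Letters `d`, `a`, `b`, `v`, `i`, `x`, `u` stand for names of registers, `k`
for a constant and `l` for a position in the program. -/
inductive Instr
  /-- `d := k`. -/
  | const (d k : ℕ)
  /-- `d := a`. -/
  | move (d a : ℕ)
  /-- `d := a + b`, modulo `2 ^ w`. -/
  | add (d a b : ℕ)
  /-- `d := a - b`, modulo `2 ^ w`. -/
  | sub (d a b : ℕ)
  /-- Continue at `l`. -/
  | jump (l : ℕ)
  /-- Continue at `l` if `a < b`. -/
  | jumpLt (a b l : ℕ)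
  /-- Continue at `l` if `a = b`. -/
  | jumpEq (a b l : ℕ)
  /-- `d :=` the number of vertices. -/
  | numVerts (d : ℕ)
  /-- `d :=` the degree of the vertex in `v`. -/
  | degree (d v : ℕ)
  /-- `d :=` entry number `i` (counted from `0`) of the adjacency list of the vertex in `v`. -/
  | neighbor (d v i : ℕ)
  /-- Make the reserved block of uninitialized memory `a` words long. -/
  | reserve (a : ℕ)
  /-- `d := mem[a]`. -/
  | load (d a : ℕ)
  /-- `mem[a] := x`. -/
  | store (a x : ℕ)
  /-- Reserve lazy-initialized memory of `a` cells, none of which counts as written. -/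
  | lazyReserve (a : ℕ)
  /-- `d := 1` if the lazy-initialized cell `a` has been written, else `d := 0`. -/
  | lazyTest (d a : ℕ)
  /-- `d :=` the value of the lazy-initialized cell `a`, or `0` if it has not been written. -/
  | lazyLoad (d a : ℕ)
  /-- Write `x` to the lazy-initialized cell `a`. -/
  | lazyStore (a x : ℕ)
  /-- Output the triple of the values of `u`, `v` and `x`. -/
  | emit (u v x : ℕ)
  /-- Output the triple of the value of `u`, the value of `v`, and infinity. -/
  | emitInf (u v : ℕ)
  /-- Stop, reporting that there is no further output. -/
  | halt

/-- A program: a finite list of instructions, fixed once and for all. -/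
abbrev Program := List Instr

/-- An output `(u, v, x)`: two vertices and a distance. -/
abbrev Output := ℕ × ℕ × ℕ∞

/-- Contents of the memory. `mem` is ordinary memory. Lazy-initialized memory is realized on top of
uninitialized memory: `slot x` is the pointer stored for cell `x`, and `(key j, val j)` is pair
number `j` of the auxiliary memory, holding a back pointer and a value. -/
structure Contents where
  /-- Ordinary memory. -/
  mem : ℕ → ℕ
  /-- The pointers of the lazy-initialized cells. -/
  slot : ℕ → ℕ
  /-- The back pointers of the auxiliary pairs. -/
  key : ℕ → ℕ
  /-- The values of the auxiliary pairs. -/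
  val : ℕ → ℕ

/-- All memory cells hold words of `w` bits. -/
def Contents.IsWords (w : ℕ) (μ : Contents) : Prop :=
  ∀ a, μ.mem a < 2 ^ w ∧ μ.slot a < 2 ^ w ∧ μ.key a < 2 ^ w ∧ μ.val a < 2 ^ w

/-- Configurations of the machine. -/
structure Config extends Contents where
  /-- Position of the next instruction. -/
  pc : ℕ
  /-- Registers. -/
  reg : ℕ → ℕ
  /-- Number of reserved words of ordinary memory. -/
  memSize : ℕ
  /-- Number of reserved cells of lazy-initialized memory. -/
  lazySize : ℕ
  /-- Number of auxiliary pairs in use. -/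
  lazyCount : ℕ
  /-- The outputs so far, oldest first. -/
  out : List Output

namespace Config

/-- Proceed to the next instruction. -/
def next (c : Config) : Config := { c with pc := c.pc + 1 }

/-- Write a word of `w` bits to register `d`. -/
def setReg (w : ℕ) (c : Config) (d x : ℕ) : Config :=
  { c with reg := Function.update c.reg d (x % 2 ^ w) }

/-- Whether the lazy-initialized cell `x` has been written: its pointer leads to a pair in use whose
back pointer is `x`. -/
def LazyWritten (c : Config) (x : ℕ) : Prop :=
  c.slot x < c.lazyCount ∧ c.key (c.slot x) = x

instance (c : Config) (x : ℕ) : Decidable (c.LazyWritten x) :=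
  inferInstanceAs (Decidable (_ ∧ _))

/-- Write `y` to the lazy-initialized cell `x`, using a new auxiliary pair if `x` has not been
written before. -/
def lazyWrite (c : Config) (x y : ℕ) : Config :=
  if c.LazyWritten x then
    { c with val := Function.update c.val (c.slot x) y }
  else
    { c with
      slot := Function.update c.slot x c.lazyCount
      key := Function.update c.key c.lazyCount x
      val := Function.update c.val c.lazyCount y
      lazyCount := c.lazyCount + 1 }

/-- The words of memory in use: the reserved ordinary memory and, for lazy-initialized memory of
size `k`, the `k` pointers, `k` auxiliary pairs and one counter. (The constantly many registers
are not counted.) -/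
def space (c : Config) : ℕ := c.memSize + (3 * c.lazySize + 1)

end Config

/-- The configuration at the start: no memory is reserved, the memory contents are given by `μ`,
register `0` holds `s`, and all other registers hold `0`. -/
def start (μ : Contents) (s : ℕ) : Config where
  toContents := μ
  pc := 0
  reg := Function.update (fun _ => 0) 0 s
  memSize := 0
  lazySize := 0
  lazyCount := 0
  out := []

section Execution

variable (P : Program) (w : ℕ) {n : ℕ} (L : Fin n → List (Fin n))

/-- One instruction, with words of `w` bits, on the read-only input graph with vertices
`0, …, n - 1` and adjacency lists `L`. On an illegal access (a number that is not a vertex, an index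
beyond the end of a list, memory that is not reserved) the machine hangs. -/
def exec (c : Config) : Instr → Config
  | .const d k => (c.setReg w d k).next
  | .move d a => (c.setReg w d (c.reg a)).next
  | .add d a b => (c.setReg w d (c.reg a + c.reg b)).next
  | .sub d a b => (c.setReg w d (c.reg a + 2 ^ w - c.reg b)).next
  | .jump l => { c with pc := l }
  | .jumpLt a b l => if c.reg a < c.reg b then { c with pc := l } else c.next
  | .jumpEq a b l => if c.reg a = c.reg b then { c with pc := l } else c.next
  | .numVerts d => (c.setReg w d n).next
  | .degree d v =>
      if h : c.reg v < n then (c.setReg w d (L ⟨c.reg v, h⟩).length).next else c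
  | .neighbor d v i =>
      if h : c.reg v < n then
        if h' : c.reg i < (L ⟨c.reg v, h⟩).length then
          (c.setReg w d (L ⟨c.reg v, h⟩)[c.reg i]).next
        else c
      else c
  | .reserve a => { c with memSize := c.reg a }.next
  | .load d a => if c.reg a < c.memSize then (c.setReg w d (c.mem (c.reg a))).next else c
  | .store a x =>
      if c.reg a < c.memSize then
        { c with mem := Function.update c.mem (c.reg a) (c.reg x) }.next
      else c
  | .lazyReserve a => { c with lazySize := c.reg a, lazyCount := 0 }.next
  | .lazyTest d a =>
      if c.reg a < c.lazySize then
        (c.setReg w d (if c.LazyWritten (c.reg a) then 1 else 0)).next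
      else c
  | .lazyLoad d a =>
      if c.reg a < c.lazySize then
        (c.setReg w d (if c.LazyWritten (c.reg a) then c.val (c.slot (c.reg a)) else 0)).next
      else c
  | .lazyStore a x =>
      if c.reg a < c.lazySize then (c.lazyWrite (c.reg a) (c.reg x)).next else c
  | .emit u v x => { c with out := c.out ++ [(c.reg u, c.reg v, (c.reg x : ℕ∞))] }.next
  | .emitInf u v => { c with out := c.out ++ [(c.reg u, c.reg v, ⊤)] }.next
  | .halt => c

/-- One step of the program. (Running off the end of the program is not halting.) -/
def step (c : Config) : Config :=
  match P[c.pc]? with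
  | some ins => exec w L c ins
  | none => c

/-- The program has reached a `halt` instruction. -/
def Halted (c : Config) : Prop := P[c.pc]? = some .halt

/-- The configuration after `t` steps. -/
def run (c : Config) (t : ℕ) : Config := (step P w L)^[t] c

/-- Started in `c`, the program halts, and the list of all its outputs satisfies `Sol`. -/
def Enumerates (c : Config) (Sol : List Output → Prop) : Prop :=
  ∃ t, Halted P (run P w L c t) ∧ Sol (run P w L c t).out

/-- At every moment (the start included), the next output or the halt is at most `D` steps away.
So the time up to the first output, the time between two consecutive outputs, and the time from
the last output to the halt are all at most `D`; there is no preprocessing. -/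
def DelayLE (c : Config) (D : ℕ) : Prop :=
  ∀ t, (run P w L c t).out.length < (run P w L c (t + D)).out.length ∨
    Halted P (run P w L c (t + D))

/-- The maximum over time of the quantity `f` lies between `n / C` and `C * n`. -/
def PeakBetween (c : Config) (f : Config → ℕ) (C : ℕ) : Prop :=
  (∃ t, n ≤ C * f (run P w L c t)) ∧ ∀ t, f (run P w L c t) ≤ C * n

end Execution

end WordRAM

/-! ### The enumeration problems -/

/-- `l` lists, each exactly once, the triples `(s, t, d(s, t))` for all vertices `t`. -/
def IsSSSDEnumeration {n : ℕ} (G : Digraph (Fin n)) (s : Fin n) (l : List WordRAM.Output) : Prop :=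
  l.Nodup ∧ ∀ x, x ∈ l ↔ ∃ t : Fin n, x = (s.val, t.val, G.hopDist s t)

/-- `l` lists, each exactly once, the triples `(u, v, d(u, v))` for all pairs of vertices, sorted by
the source vertex `u`. -/
def IsRowWiseAPSDEnumeration {n : ℕ} (G : Digraph (Fin n)) (l : List WordRAM.Output) : Prop :=
  l.Nodup ∧ (∀ x, x ∈ l ↔ ∃ u v : Fin n, x = (u.val, v.val, G.hopDist u v)) ∧
    l.Pairwise fun x y => x.1 ≤ y.1

/-!
# Shortest distance enumeration on the word RAM

Breadth-first search outputs a vertex when it takes it from its queue, and then scans the adjacency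
list in time `O(Δ)`. So the delay is as required as long as the queue is not empty. The difficulty
is to list the unreachable vertices afterwards: a scan over all vertices may have to skip many
reachable ones in a row, and there is no time for a list of undiscovered vertices to be set up in
advance.

The remedy is to keep all vertices in one permutation `σ`, together with its inverse, such that the
first `c` entries are the discovered vertices in the order of their discovery. This prefix is the
queue of the search; a vertex `v` has been discovered if and only if `σ⁻¹ v < c`; discovering it
means to swap it to position `c` and to increase `c` (`Grow.swap`); and the vertices that remain
undiscovered at the end are the entries from `c` on, which are listed with constant delay. Initially
`σ` is the identity. It needs no initialization, as `σ i - i` and `σ⁻¹ v - v` are stored in `2 n`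
lazy-initialized cells, which are read as `0` before they are written (`Encodes`). Distances are not
stored: it suffices to know the current level and the position `e` at which it ends (`BFSInv`). For
all pairs, the rows are enumerated one after the other, each starting with the permutation that the
previous one has left.

The program is verified by weakest preconditions: `Ensures B p r m z Q` says that from position `p`,
with registers `r` and lazy-initialized memory `m` of `z` cells, the program halts, that its outputs
satisfy `Q`, that the first delay is at most `B`, and that all others are at most a fixed `D`. There
is one rule for each instruction used. `Trace.delayLE` turns this into the bound on the delay, and
`enumerator_peaks` bounds the memory. Both problems are solved by the same program up to the one
instruction that determines the range of sources.
-/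

/-! ### Hop distances -/

namespace Digraph

variable {V : Type*} {G : Digraph V} {u v x : V} {k : ℕ}

theorem HopWalk.snoc (p : G.HopWalk k u v) (h : G.Adj v x) : G.HopWalk (k + 1) u x := by
  induction p with
  | nil v => exact .cons h (.nil _)
  | cons h' _ ih => exact .cons h' (ih h)

theorem HopWalk.exists_snoc (p : G.HopWalk (k + 1) u x) :
    ∃ v, G.HopWalk k u v ∧ G.Adj v x := by
  induction k generalizing u with
  | zero =>
    cases p with
    | cons h p => cases p; exact ⟨u, .nil u, h⟩
  | succ k ih =>
    cases p with
    | cons h p =>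
      obtain ⟨v, q, hv⟩ := ih p
      exact ⟨v, .cons h q, hv⟩

theorem hopDist_le_iff : G.hopDist u v ≤ k ↔ ∃ j ≤ k, G.HopWalk j u v := by
  constructor
  · intro h
    by_contra! hno
    have h' : ((k + 1 : ℕ) : ℕ∞) ≤ G.hopDist u v := by
      refine le_iInf₂ fun j hj => ?_
      by_contra! hlt
      exact hno j (by norm_cast at hlt; omega) hj
    have := h'.trans h
    norm_cast at this
    omega
  · rintro ⟨j, hj, p⟩
    exact iInf₂_le_of_le j p (by exact_mod_cast hj)

theorem hopDist_le_zero_iff : G.hopDist u v ≤ (0 : ℕ) ↔ v = u := by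
  rw [hopDist_le_iff]
  constructor
  · rintro ⟨j, hj, p⟩
    obtain rfl : j = 0 := by omega
    cases p; rfl
  · rintro rfl
    exact ⟨0, le_rfl, .nil _⟩

theorem hopDist_le_succ_iff :
    G.hopDist u x ≤ (k + 1 : ℕ) ↔ G.hopDist u x ≤ k ∨ ∃ v, G.hopDist u v ≤ k ∧ G.Adj v x := by
  simp only [hopDist_le_iff]
  constructor
  · rintro ⟨j, hj, p⟩
    rcases Nat.lt_or_ge k j with hlt | hle
    · obtain rfl : j = k + 1 := by omega
      obtain ⟨v, q, hv⟩ := p.exists_snoc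
      exact .inr ⟨v, ⟨k, le_rfl, q⟩, hv⟩
    · exact .inl ⟨j, hle, p⟩
  · rintro (⟨j, hj, p⟩ | ⟨v, ⟨j, hj, p⟩, hv⟩)
    · exact ⟨j, by omega, p⟩
    · exact ⟨j + 1, by omega, p.snoc hv⟩

theorem outDeg_eq_length {n : ℕ} {G : Digraph (Fin n)} {L : Fin n → List (Fin n)}
    (hL : G.IsAdjLists L) (v : Fin n) : G.outDeg v = (L v).length := by
  have h : {u | G.Adj v u} = ((L v).toFinset : Set (Fin n)) := by
    ext u; simp [(hL v).2 u]
  rw [outDeg, h, Set.ncard_coe_finset, List.toFinset_card_of_nodup (hL v).1]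

end Digraph

/-! ### Breadth-first search on a permutation -/

namespace WordRAM

open Digraph

section Search

variable {n : ℕ}

/-- The vertices `σ 0, σ 1, …` are listed in a row, and the first `c` of them have been discovered.
`Grow σ c σ' c' S` says that `(σ', c')` arises from `(σ, c)` by discovering the vertices in `S`: no
prefix of discovered vertices is changed as a set. -/
structure Grow (σ : Equiv.Perm (Fin n)) (c : ℕ) (σ' : Equiv.Perm (Fin n)) (c' : ℕ)
    (S : Set (Fin n)) : Prop where
  le : c ≤ c'
  le_card : c' ≤ n
  found : ∀ v, (σ'.symm v : ℕ) < c' ↔ (σ.symm v : ℕ) < c ∨ v ∈ S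
  stable : ∀ k ≤ c, ∀ v, (σ'.symm v : ℕ) < k ↔ (σ.symm v : ℕ) < k

variable {σ σ' σ'' : Equiv.Perm (Fin n)} {c c' c'' : ℕ} {S T : Set (Fin n)} {v : Fin n}

theorem Grow.of_subset (hc : c ≤ n) (hS : ∀ v ∈ S, (σ.symm v : ℕ) < c) : Grow σ c σ c S where
  le := le_rfl
  le_card := hc
  found v := ⟨.inl, fun h => h.elim id (hS v)⟩
  stable _ _ _ := Iff.rfl

theorem Grow.trans (h : Grow σ c σ' c' S) (h' : Grow σ' c' σ'' c'' T) :
    Grow σ c σ'' c'' (S ∪ T) where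
  le := h.le.trans h'.le
  le_card := h'.le_card
  found v := by rw [h'.found, h.found, Set.mem_union, or_assoc]
  stable k hk v := by rw [h'.stable k (hk.trans h.le), h.stable k hk]

theorem Grow.swap (hc : c < n) (hv : c ≤ (σ.symm v : ℕ)) :
    Grow σ c ((Equiv.swap ⟨c, hc⟩ (σ.symm v)).trans σ) (c + 1) {v} := by
  have key : ∀ u, ((((Equiv.swap ⟨c, hc⟩ (σ.symm v)).trans σ).symm u : Fin n) : ℕ) =
      if u = v then c else if (σ.symm u : ℕ) = c then (σ.symm v : ℕ) else (σ.symm u : ℕ) := by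
    intro u
    rw [Equiv.symm_trans_apply, Equiv.symm_swap]
    by_cases huv : u = v
    · subst huv; simp
    · by_cases hu : (σ.symm u : ℕ) = c
      · have : σ.symm u = ⟨c, hc⟩ := Fin.ext hu
        simp [huv, this]
      · have h1 : σ.symm u ≠ ⟨c, hc⟩ := fun h => hu (congrArg Fin.val h)
        have h2 : σ.symm u ≠ σ.symm v := fun h => huv (σ.symm.injective h)
        rw [Equiv.swap_apply_of_ne_of_ne h1 h2, if_neg huv, if_neg hu]
  have ne : ∀ u, u ≠ v → (σ.symm u : ℕ) ≠ (σ.symm v : ℕ) := fun u huv h =>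
    huv (σ.symm.injective (Fin.ext h))
  refine ⟨by omega, hc, fun u => ?_, fun k hk u => ?_⟩
  · rw [key, Set.mem_singleton_iff]
    have := ne u
    split_ifs with h1 h2
    · simp [h1]
    · have := this h1
      simp only [h1, or_false]
      omega
    · simp only [h1, or_false]
      omega
  · rw [key]
    split_ifs with h1 h2
    · subst h1; omega
    · omega
    · rfl

/-- The state of a breadth-first search from `s`. The vertices at positions below `h` have been
processed, those below `c` have been discovered, and those below `e` form the ball of radius `d`
about `s`; the next vertices to process, from `h` up to `e`, have distance exactly `d`. -/
structure BFSInv (G : Digraph (Fin n)) (s : Fin n) (σ : Equiv.Perm (Fin n)) (h c e d : ℕ) :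
    Prop where
  head_le : h ≤ e
  level_le : e ≤ c
  le_card : c ≤ n
  dist_lt : d < e
  ball : ∀ v, (σ.symm v : ℕ) < e ↔ G.hopDist s v ≤ d
  processed : ∀ v, G.hopDist s v < d → (σ.symm v : ℕ) < h
  found : ∀ v, (σ.symm v : ℕ) < c ↔
    (σ.symm v : ℕ) < e ∨ ∃ u, (σ.symm u : ℕ) < h ∧ G.Adj u v

variable {G : Digraph (Fin n)} {s : Fin n} {h e d : ℕ}

theorem BFSInv.init (hg : Grow σ 0 σ' c' {s}) : BFSInv G s σ' 0 c' 1 0 := by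
  have hs : ∀ v, (σ'.symm v : ℕ) < c' ↔ v = s := fun v => by simp [hg.found v]
  -- Exactly one vertex has been discovered, so `c' = 1`.
  have hpos : 0 < c' := (Nat.zero_le _).trans_lt ((hs s).2 rfl)
  have hc : c' = 1 := by
    by_contra hne
    have h0 := (hs (σ' ⟨0, by have := hg.le_card; omega⟩)).1 (by simpa using hpos)
    have h1 := (hs (σ' ⟨1, by have := hg.le_card; omega⟩)).1 (by simp; omega)
    have := σ'.injective (h0.trans h1.symm)
    simp at this
  subst hc
  exact ⟨by omega, le_rfl, hg.le_card, by omega,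
    fun v => by rw [hs, hopDist_le_zero_iff], fun v hv => by simp at hv, fun v => by simp⟩

theorem BFSInv.nextLevel (hI : BFSInv G s σ h c e d) (he : h = e) (hc : h < c) :
    BFSInv G s σ h c c (d + 1) := by
  subst he
  have := hI.dist_lt
  refine ⟨hc.le, le_rfl, hI.le_card, by omega, fun v => ?_, fun v hv => ?_, fun v => ?_⟩
  · rw [hI.found, hopDist_le_succ_iff]
    simp only [hI.ball]
  · rw [hI.ball]
    exact Order.le_of_lt_add_one (by exact_mod_cast hv)
  · refine ⟨.inl, fun hv => hv.elim id fun hu => ?_⟩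
    exact (hI.found v).2 (.inr hu)

theorem BFSInv.hopDist_head (hI : BFSInv G s σ h c e d) (hh : h < n) (he : h < e) :
    G.hopDist s (σ ⟨h, hh⟩) = d := by
  refine le_antisymm ((hI.ball _).1 (by simpa using he)) (not_lt.1 fun hlt => ?_)
  have := hI.processed _ hlt
  simp at this

theorem BFSInv.process (hI : BFSInv G s σ h c e d) (hh : h < n) (he : h < e)
    (hg : Grow σ c σ' c' {v | G.Adj (σ ⟨h, hh⟩) v}) : BFSInv G s σ' (h + 1) c' e d := by
  have hle := hI.level_le
  refine ⟨he, hle.trans hg.le, hg.le_card, hI.dist_lt, fun v => ?_, fun v hv => ?_, fun v => ?_⟩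
  · rw [hg.stable e hle, hI.ball]
  · have := (hg.stable h (by omega) v).2 (hI.processed v hv)
    omega
  · rw [hg.found, hI.found, hg.stable e hle, or_assoc]
    refine or_congr_right ?_
    have hpos : ∀ u, (σ'.symm u : ℕ) < h + 1 ↔ (σ.symm u : ℕ) < h ∨ u = σ ⟨h, hh⟩ := by
      intro u
      rw [hg.stable (h + 1) (by omega), Nat.lt_succ_iff_lt_or_eq, ← Equiv.symm_apply_eq, Fin.ext_iff]
    simp only [hpos, Set.mem_ofPred_eq, or_and_right, exists_or, exists_eq_left]

theorem BFSInv.hopDist_eq_top (hI : BFSInv G s σ h c e d) (hc : c ≤ h)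
    (hv : c ≤ (σ.symm v : ℕ)) : G.hopDist s v = ⊤ := by
  have h1 := hI.head_le
  have h2 := hI.level_le
  obtain rfl : e = h := by omega
  obtain rfl : c = e := by omega
  -- The ball of radius `d` is closed under taking out-neighbours.
  have key : ∀ k u, G.HopWalk k s u → (σ.symm u : ℕ) < c := by
    intro k
    induction k with
    | zero =>
      intro u p
      cases p
      exact (hI.ball s).2 (hopDist_le_iff.2 ⟨0, by omega, .nil s⟩)
    | succ k ih =>
      intro u p
      obtain ⟨x, q, hx⟩ := p.exists_snoc
      exact (hI.found u).2 (.inr ⟨x, ih x q, hx⟩)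
  refine iInf₂_eq_top.2 fun k p => ?_
  have := key k v p
  omega

end Search

/-! ### Outputs -/

section Outputs

variable {n : ℕ}

/-- `l` lists the distances from all sources `u` with `a ≤ u < b`, sorted by the source. -/
def RowsFrom (G : Digraph (Fin n)) (a b : ℕ) (l : List Output) : Prop :=
  l.Nodup ∧ (∀ x, x ∈ l ↔ ∃ u v : Fin n, a ≤ u.val ∧ u.val < b ∧
    x = (u.val, v.val, G.hopDist u v)) ∧ l.Pairwise fun x y => x.1 ≤ y.1

/-- `l` lists the distances from `s` to the vertices at positions `≥ h` in `σ`, followed by the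
distances from all sources `u` with `s < u < b`. -/
def RowRest (G : Digraph (Fin n)) (s : Fin n) (b : ℕ) (σ : Equiv.Perm (Fin n)) (h : ℕ)
    (l : List Output) : Prop :=
  ∃ (vs : List (Fin n)) (rest : List Output),
    l = vs.map (fun v => (s.val, v.val, G.hopDist s v)) ++ rest ∧ vs.Nodup ∧
    (∀ v, v ∈ vs ↔ h ≤ (σ.symm v : ℕ)) ∧ RowsFrom G (s + 1) b rest

variable {G : Digraph (Fin n)} {s : Fin n} {b h : ℕ} {σ σ' : Equiv.Perm (Fin n)} {l : List Output}

theorem rowsFrom_nil (a : ℕ) : RowsFrom G a a [] :=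
  ⟨.nil, fun x => by simp only [List.not_mem_nil, false_iff]; rintro ⟨u, v, h1, h2, -⟩; omega, .nil⟩

theorem RowRest.of_rowsFrom (hh : n ≤ h) (hl : RowsFrom G (s + 1) b l) : RowRest G s b σ h l :=
  ⟨[], l, by simp, .nil, fun v => by simp; omega, hl⟩

theorem RowRest.cons (hh : h < n) (hl : RowRest G s b σ (h + 1) l) {d : ℕ∞}
    (hd : G.hopDist s (σ ⟨h, hh⟩) = d) :
    RowRest G s b σ h ((s.val, (σ ⟨h, hh⟩).val, d) :: l) := by
  obtain ⟨vs, rest, rfl, hnd, hmem, hrest⟩ := hl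
  refine ⟨σ ⟨h, hh⟩ :: vs, rest, by simp [hd], ?_, fun v => ?_, hrest⟩
  · refine List.nodup_cons.2 ⟨fun hin => ?_, hnd⟩
    have := (hmem _).1 hin
    simp at this
  · rw [List.mem_cons, hmem, ← Equiv.symm_apply_eq, Fin.ext_iff]
    simp only
    omega

theorem RowRest.congr (hσ : ∀ v, (σ'.symm v : ℕ) < h ↔ (σ.symm v : ℕ) < h)
    (hl : RowRest G s b σ' h l) : RowRest G s b σ h l := by
  obtain ⟨vs, rest, rfl, hnd, hmem, hrest⟩ := hl
  exact ⟨vs, rest, rfl, hnd, fun v => by rw [hmem, ← not_lt, hσ, not_lt], hrest⟩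

theorem RowRest.rowsFrom (hb : s.val < b) (hl : RowRest G s b σ 0 l) : RowsFrom G s b l := by
  obtain ⟨vs, rest, rfl, hnd, hmem, h1, h2, h3⟩ := hl
  have hlt : ∀ x ∈ rest, s.val < x.1 := by
    intro x hx
    obtain ⟨u, v, hu, -, rfl⟩ := (h2 x).1 hx
    exact hu
  refine ⟨List.nodup_append.2 ⟨hnd.map fun u v huv => ?_, h1, ?_⟩, fun x => ?_,
    List.pairwise_append.2 ⟨?_, h3, ?_⟩⟩
  · simp only [Prod.mk.injEq] at huv
    exact Fin.ext huv.2.1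
  · rintro x hx y hy rfl
    obtain ⟨v, -, rfl⟩ := List.mem_map.1 hx
    exact lt_irrefl _ (hlt _ hy)
  · rw [List.mem_append, List.mem_map, h2]
    constructor
    · rintro (⟨v, -, rfl⟩ | ⟨u, v, hu, hu', rfl⟩)
      · exact ⟨s, v, le_rfl, hb, rfl⟩
      · exact ⟨u, v, by omega, hu', rfl⟩
    · rintro ⟨u, v, hu, hu', rfl⟩
      rcases hu.eq_or_lt with heq | hlt'
      · obtain rfl : s = u := Fin.ext heq
        exact .inl ⟨v, (hmem v).2 (Nat.zero_le _), rfl⟩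
      · exact .inr ⟨u, v, hlt', hu', rfl⟩
  · exact List.pairwise_map.2 (List.pairwise_of_forall fun _ _ => le_rfl)
  · intro x hx y hy
    obtain ⟨v, -, rfl⟩ := List.mem_map.1 hx
    exact (hlt y hy).le

end Outputs

/-! ### Lazy-initialized memory -/

/-- The value read from lazy-initialized cell `x`. -/
def Config.lazyVal (c : Config) (x : ℕ) : ℕ :=
  if c.LazyWritten x then c.val (c.slot x) else 0

theorem Config.lazyVal_lazyWrite (c : Config) (x y : ℕ) :
    (c.lazyWrite x y).lazyVal = Function.update c.lazyVal x y := by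
  funext z
  by_cases hx : c.LazyWritten x
  · by_cases hz : z = x
    · subst hz
      have hx' := hx
      simp only [LazyWritten] at hx'
      simp [lazyVal, lazyWrite, LazyWritten, hx']
    · -- Written cells lead to different pairs, as their back pointers differ.
      have hne : c.LazyWritten z → c.slot z ≠ c.slot x := fun h heq =>
        hz (by rw [← h.2, heq, hx.2])
      simp only [lazyVal, lazyWrite, if_pos hx, Function.update_of_ne hz]
      by_cases h : c.LazyWritten z
      · rw [if_pos h, if_pos (by exact h), Function.update_of_ne (hne h)]
      · rw [if_neg h, if_neg (by exact h)]
  · have hw : c.lazyWrite x y = _ := if_neg hx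
    rw [hw]
    by_cases hz : z = x
    · subst hz
      simp [lazyVal, LazyWritten]
    · rw [Function.update_of_ne hz]
      simp only [lazyVal, LazyWritten, Function.update_of_ne hz]
      rcases lt_trichotomy (c.slot z) c.lazyCount with h | h | h
      · simp only [Function.update_of_ne h.ne, h, h.trans (Nat.lt_succ_self _), true_and]
      · simp [h, Ne.symm hz]
      · simp [h.not_gt, (Nat.succ_le_of_lt h).not_gt]

section LazyWrite

variable (c : Config) (x y : ℕ)

theorem Config.lazyWrite_pc : (c.lazyWrite x y).pc = c.pc := by
  unfold lazyWrite; split <;> rfl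

theorem Config.lazyWrite_reg : (c.lazyWrite x y).reg = c.reg := by
  unfold lazyWrite; split <;> rfl

theorem Config.lazyWrite_lazySize : (c.lazyWrite x y).lazySize = c.lazySize := by
  unfold lazyWrite; split <;> rfl

theorem Config.lazyWrite_memSize : (c.lazyWrite x y).memSize = c.memSize := by
  unfold lazyWrite; split <;> rfl

theorem Config.lazyWrite_out : (c.lazyWrite x y).out = c.out := by
  unfold lazyWrite; split <;> rfl

end LazyWrite

/-! ### Computations with bounded delay -/

section Trace

variable (P : Program) (w : ℕ) {n : ℕ} (L : Fin n → List (Fin n)) (D : ℕ)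

/-- From `c` on, the program outputs `l` and halts. The first output (or the halt, if there is
none) is at most `B` steps away, and every other delay is at most `D`. -/
inductive Trace : ℕ → Config → List Output → Prop
  | halt {B : ℕ} {c : Config} (h : Halted P c) : Trace B c []
  | silent {B : ℕ} {c : Config} {l : List Output} (h : (step P w L c).out = c.out)
      (h' : Trace B (step P w L c) l) : Trace (B + 1) c l
  | emit {B : ℕ} {c : Config} {x : Output} {l : List Output}
      (h : (step P w L c).out = c.out ++ [x]) (h' : Trace D (step P w L c) l) :
      Trace (B + 1) c (x :: l)

variable {P w L D} {B : ℕ} {c : Config} {l : List Output}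

theorem run_zero : run P w L c 0 = c := rfl

theorem run_succ (t : ℕ) : run P w L c (t + 1) = run P w L (step P w L c) t :=
  Function.iterate_succ_apply _ _ _

theorem run_succ_eq_step (t : ℕ) : run P w L c (t + 1) = step P w L (run P w L c t) :=
  Function.iterate_succ_apply' _ _ _

theorem run_of_halted (h : Halted P c) (t : ℕ) : run P w L c t = c := by
  have hs : step P w L c = c := by
    rw [Halted] at h
    simp [step, h, exec]
  induction t with
  | zero => rfl
  | succ t ih => rw [run_succ, hs, ih]

theorem length_out_le_step (c : Config) : c.out.length ≤ (step P w L c).out.length := by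
  unfold step
  split
  · rename_i ins _
    cases ins <;> simp only [exec] <;> (repeat' split) <;>
      simp [Config.next, Config.setReg, Config.lazyWrite_out]
  · exact le_rfl

theorem length_out_le_run (c : Config) (t : ℕ) : c.out.length ≤ (run P w L c t).out.length := by
  induction t with
  | zero => exact le_rfl
  | succ t ih => rw [run_succ_eq_step]; exact ih.trans (length_out_le_step _)

theorem Trace.mono (h : Trace P w L D B c l) {B' : ℕ} (hB : B ≤ B') : Trace P w L D B' c l := by
  induction h generalizing B' with
  | halt h => exact .halt h
  | silent h _ ih =>
    obtain ⟨k, rfl⟩ := Nat.exists_eq_add_of_le' (Nat.one_le_of_lt (Nat.lt_of_succ_le hB))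
    exact .silent h (ih (by omega))
  | emit h h' _ =>
    obtain ⟨k, rfl⟩ := Nat.exists_eq_add_of_le' (Nat.one_le_of_lt (Nat.lt_of_succ_le hB))
    exact .emit h h'

theorem Trace.exists_halted (h : Trace P w L D B c l) :
    ∃ t, Halted P (run P w L c t) ∧ (run P w L c t).out = c.out ++ l := by
  induction h with
  | halt h => exact ⟨0, h, by simp [run_zero]⟩
  | silent h _ ih =>
    obtain ⟨t, h1, h2⟩ := ih
    exact ⟨t + 1, by rwa [run_succ], by rw [run_succ, h2, h]⟩
  | emit h _ ih =>
    obtain ⟨t, h1, h2⟩ := ih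
    exact ⟨t + 1, by rwa [run_succ], by rw [run_succ, h2, h]; simp⟩

theorem Trace.progress (h : Trace P w L D B c l) :
    c.out.length < (run P w L c B).out.length ∨ Halted P (run P w L c B) := by
  induction h with
  | halt h => exact .inr (by rwa [run_of_halted h])
  | silent h _ ih => rw [run_succ, ← h]; exact ih
  | emit h _ _ =>
    refine .inl ?_
    rw [run_succ]
    refine lt_of_lt_of_le ?_ (length_out_le_run _ _)
    rw [h]; simp

theorem Trace.delayLE (h : Trace P w L D B c l) (hB : B ≤ D) : DelayLE P w L c D := by
  intro t
  induction t generalizing c B l with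
  | zero => rw [Nat.zero_add]; exact (h.mono hB).progress
  | succ t ih =>
    rw [Nat.succ_add, run_succ, run_succ]
    cases h with
    | halt h =>
      have hs : step P w L c = c := run_of_halted h 1
      exact .inr (by rw [hs, run_of_halted h]; exact h)
    | silent _ h' => exact ih h' (by omega)
    | emit _ h' => exact ih h' le_rfl

end Trace

/-! ### Weakest preconditions -/

section Ensures

variable (P : Program) (w : ℕ) {n : ℕ} (L : Fin n → List (Fin n)) (D : ℕ)

/-- The part of a configuration that a program without ordinary memory can see: its position `p`,
its registers `r`, the readable contents `m` of lazy-initialized memory, and its size `z`. -/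
def View (p : ℕ) (r m : ℕ → ℕ) (z : ℕ) (c : Config) : Prop :=
  c.pc = p ∧ c.reg = r ∧ c.lazyVal = m ∧ c.lazySize = z

/-- From every configuration with the given view, the program halts after outputs satisfying `Q`,
with all delays at most `D` and the first one at most `B`. -/
def Ensures (B p : ℕ) (r m : ℕ → ℕ) (z : ℕ) (Q : List Output → Prop) : Prop :=
  ∀ c, View p r m z c → ∃ l, Trace P w L D B c l ∧ Q l

variable {P w L D} {B B' p p' d a b i k x : ℕ} {r r' m m' : ℕ → ℕ} {z z' : ℕ}
  {Q Q' : List Output → Prop} {ins : Instr}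

theorem Ensures.mono (h : Ensures P w L D B p r m z Q) (hB : B ≤ B')
    (hQ : ∀ l, Q l → Q' l) : Ensures P w L D B' p r m z Q' := fun c hc => by
  obtain ⟨l, hl, hl'⟩ := h c hc
  exact ⟨l, hl.mono hB, hQ l hl'⟩

theorem Ensures.halt (hP : P[p]? = some .halt) (hQ : Q []) : Ensures P w L D B p r m z Q :=
  fun c hc => ⟨[], .halt (by rw [Halted, hc.1, hP]), hQ⟩

theorem Ensures.silent (hP : P[p]? = some ins)
    (hs : ∀ c, View p r m z c →
      View p' r' m' z' (exec w L c ins) ∧ (exec w L c ins).out = c.out)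
    (h : Ensures P w L D B p' r' m' z' Q) : Ensures P w L D (B + 1) p r m z Q := fun c hc => by
  have hstep : step P w L c = exec w L c ins := by simp [step, hc.1, hP]
  obtain ⟨l, hl, hl'⟩ := h _ (hs c hc).1
  exact ⟨l, .silent (by rw [hstep]; exact (hs c hc).2) (by rwa [hstep]), hl'⟩

theorem Ensures.const (hP : P[p]? = some (.const d k)) (hk : k < 2 ^ w)
    (h : Ensures P w L D B (p + 1) (Function.update r d k) m z Q) :
    Ensures P w L D (B + 1) p r m z Q := by
  refine Ensures.silent hP ?_ h
  rintro c ⟨rfl, rfl, rfl, rfl⟩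
  refine ⟨⟨rfl, ?_, rfl, rfl⟩, rfl⟩
  simp [exec, Config.next, Config.setReg, Nat.mod_eq_of_lt hk]

theorem Ensures.move (hP : P[p]? = some (.move d a)) (hx : r a = x) (hlt : x < 2 ^ w)
    (h : Ensures P w L D B (p + 1) (Function.update r d x) m z Q) :
    Ensures P w L D (B + 1) p r m z Q := by
  refine Ensures.silent hP ?_ h
  rintro c ⟨rfl, rfl, rfl, rfl⟩
  refine ⟨⟨rfl, ?_, rfl, rfl⟩, rfl⟩
  simp [exec, Config.next, Config.setReg, hx, Nat.mod_eq_of_lt hlt]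

theorem Ensures.add (hP : P[p]? = some (.add d a b)) (hx : (r a + r b) % 2 ^ w = x)
    (h : Ensures P w L D B (p + 1) (Function.update r d x) m z Q) :
    Ensures P w L D (B + 1) p r m z Q := by
  refine Ensures.silent hP ?_ h
  rintro c ⟨rfl, rfl, rfl, rfl⟩
  refine ⟨⟨rfl, ?_, rfl, rfl⟩, rfl⟩
  simp [exec, Config.next, Config.setReg, hx]

theorem Ensures.add_of_lt (hP : P[p]? = some (.add d a b)) (hx : r a + r b = x) (hlt : x < 2 ^ w)
    (h : Ensures P w L D B (p + 1) (Function.update r d x) m z Q) :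
    Ensures P w L D (B + 1) p r m z Q :=
  Ensures.add hP (by rw [hx, Nat.mod_eq_of_lt hlt]) h

theorem Ensures.sub (hP : P[p]? = some (.sub d a b)) (hx : (r a + 2 ^ w - r b) % 2 ^ w = x)
    (h : Ensures P w L D B (p + 1) (Function.update r d x) m z Q) :
    Ensures P w L D (B + 1) p r m z Q := by
  refine Ensures.silent hP ?_ h
  rintro c ⟨rfl, rfl, rfl, rfl⟩
  refine ⟨⟨rfl, ?_, rfl, rfl⟩, rfl⟩
  simp [exec, Config.next, Config.setReg, hx]

theorem Ensures.jump (hP : P[p]? = some (.jump p')) (h : Ensures P w L D B p' r m z Q) :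
    Ensures P w L D (B + 1) p r m z Q := by
  refine Ensures.silent hP ?_ h
  rintro c ⟨rfl, rfl, rfl, rfl⟩
  exact ⟨⟨rfl, rfl, rfl, rfl⟩, rfl⟩

theorem Ensures.jumpLt_pos (hP : P[p]? = some (.jumpLt a b p')) (hlt : r a < r b)
    (h : Ensures P w L D B p' r m z Q) : Ensures P w L D (B + 1) p r m z Q := by
  refine Ensures.silent hP ?_ h
  rintro c ⟨rfl, rfl, rfl, rfl⟩
  rw [exec, if_pos hlt]
  exact ⟨⟨rfl, rfl, rfl, rfl⟩, rfl⟩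

theorem Ensures.jumpLt_neg (hP : P[p]? = some (.jumpLt a b p')) (hle : r b ≤ r a)
    (h : Ensures P w L D B (p + 1) r m z Q) : Ensures P w L D (B + 1) p r m z Q := by
  refine Ensures.silent hP ?_ h
  rintro c ⟨rfl, rfl, rfl, rfl⟩
  rw [exec, if_neg hle.not_gt]
  exact ⟨⟨rfl, rfl, rfl, rfl⟩, rfl⟩

theorem Ensures.jumpEq_pos (hP : P[p]? = some (.jumpEq a b p')) (heq : r a = r b)
    (h : Ensures P w L D B p' r m z Q) : Ensures P w L D (B + 1) p r m z Q := by
  refine Ensures.silent hP ?_ h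
  rintro c ⟨rfl, rfl, rfl, rfl⟩
  rw [exec, if_pos heq]
  exact ⟨⟨rfl, rfl, rfl, rfl⟩, rfl⟩

theorem Ensures.jumpEq_neg (hP : P[p]? = some (.jumpEq a b p')) (hne : r a ≠ r b)
    (h : Ensures P w L D B (p + 1) r m z Q) : Ensures P w L D (B + 1) p r m z Q := by
  refine Ensures.silent hP ?_ h
  rintro c ⟨rfl, rfl, rfl, rfl⟩
  rw [exec, if_neg hne]
  exact ⟨⟨rfl, rfl, rfl, rfl⟩, rfl⟩

theorem Ensures.numVerts (hP : P[p]? = some (.numVerts d)) (hn : n < 2 ^ w)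
    (h : Ensures P w L D B (p + 1) (Function.update r d n) m z Q) :
    Ensures P w L D (B + 1) p r m z Q := by
  refine Ensures.silent hP ?_ h
  rintro c ⟨rfl, rfl, rfl, rfl⟩
  refine ⟨⟨rfl, ?_, rfl, rfl⟩, rfl⟩
  simp [exec, Config.next, Config.setReg, Nat.mod_eq_of_lt hn]

theorem Ensures.degree (hP : P[p]? = some (.degree d a)) {u : Fin n} (hu : r a = u)
    (hlt : (L u).length < 2 ^ w)
    (h : Ensures P w L D B (p + 1) (Function.update r d (L u).length) m z Q) :
    Ensures P w L D (B + 1) p r m z Q := by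
  refine Ensures.silent hP ?_ h
  rintro c ⟨rfl, rfl, rfl, rfl⟩
  have hc : c.reg a < n := hu ▸ u.isLt
  have hf : (⟨c.reg a, hc⟩ : Fin n) = u := Fin.ext hu
  simp only [exec, dif_pos hc, hf]
  refine ⟨⟨rfl, ?_, rfl, rfl⟩, rfl⟩
  simp [Config.next, Config.setReg, Nat.mod_eq_of_lt hlt]

theorem Ensures.neighbor (hP : P[p]? = some (.neighbor d a b)) {u : Fin n} (hu : r a = u)
    (hi : r b = i) (hlen : i < (L u).length) (hn : n < 2 ^ w)
    (h : Ensures P w L D B (p + 1) (Function.update r d (L u)[i]) m z Q) :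
    Ensures P w L D (B + 1) p r m z Q := by
  refine Ensures.silent hP ?_ h
  rintro c ⟨rfl, rfl, rfl, rfl⟩
  subst hi
  have hc : c.reg a < n := hu ▸ u.isLt
  obtain rfl : (⟨c.reg a, hc⟩ : Fin n) = u := Fin.ext hu
  simp only [exec, dif_pos hc, dif_pos hlen]
  refine ⟨⟨rfl, ?_, rfl, rfl⟩, rfl⟩
  simp only [Config.next, Config.setReg]
  rw [Nat.mod_eq_of_lt (lt_trans (Fin.isLt _) hn)]

theorem Ensures.lazyReserve (hP : P[p]? = some (.lazyReserve a)) (hx : r a = x)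
    (h : Ensures P w L D B (p + 1) r (fun _ => 0) x Q) :
    Ensures P w L D (B + 1) p r m z Q := by
  refine Ensures.silent hP ?_ h
  rintro c ⟨rfl, rfl, rfl, rfl⟩
  refine ⟨⟨rfl, rfl, ?_, hx⟩, rfl⟩
  funext y
  simp [exec, Config.next, Config.lazyVal, Config.LazyWritten]

theorem Ensures.lazyLoad (hP : P[p]? = some (.lazyLoad d a)) (ha : r a < z)
    (hx : m (r a) % 2 ^ w = x)
    (h : Ensures P w L D B (p + 1) (Function.update r d x) m z Q) :
    Ensures P w L D (B + 1) p r m z Q := by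
  refine Ensures.silent hP ?_ h
  rintro c ⟨rfl, rfl, rfl, rfl⟩
  simp only [exec, if_pos ha]
  refine ⟨⟨rfl, ?_, rfl, rfl⟩, rfl⟩
  simp only [← hx, Config.lazyVal]
  rfl

theorem Ensures.lazyStore (hP : P[p]? = some (.lazyStore a b)) (ha : r a < z)
    (h : Ensures P w L D B (p + 1) r (Function.update m (r a) (r b)) z Q) :
    Ensures P w L D (B + 1) p r m z Q := by
  refine Ensures.silent hP ?_ h
  rintro c ⟨rfl, rfl, rfl, rfl⟩
  simp only [exec, if_pos ha]
  exact ⟨⟨by simp [Config.next, Config.lazyWrite_pc], Config.lazyWrite_reg _ _ _,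
    Config.lazyVal_lazyWrite _ _ _, Config.lazyWrite_lazySize _ _ _⟩, Config.lazyWrite_out _ _ _⟩

theorem Ensures.emit (hP : P[p]? = some (.emit a b d))
    (h : Ensures P w L D D (p + 1) r m z fun l => Q ((r a, r b, (r d : ℕ∞)) :: l)) :
    Ensures P w L D (B + 1) p r m z Q := by
  rintro c ⟨rfl, rfl, rfl, rfl⟩
  have hstep : step P w L c = exec w L c (.emit a b d) := by simp [step, hP]
  obtain ⟨l, hl, hl'⟩ := h (exec w L c (.emit a b d)) ⟨rfl, rfl, rfl, rfl⟩
  exact ⟨_, .emit (by rw [hstep]; rfl) (by rwa [hstep]), hl'⟩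

theorem Ensures.emitInf (hP : P[p]? = some (.emitInf a b))
    (h : Ensures P w L D D (p + 1) r m z fun l => Q ((r a, r b, (⊤ : ℕ∞)) :: l)) :
    Ensures P w L D (B + 1) p r m z Q := by
  rintro c ⟨rfl, rfl, rfl, rfl⟩
  have hstep : step P w L c = exec w L c (.emitInf a b) := by simp [step, hP]
  obtain ⟨l, hl, hl'⟩ := h (exec w L c (.emitInf a b)) ⟨rfl, rfl, rfl, rfl⟩
  exact ⟨_, .emit (by rw [hstep]; rfl) (by rwa [hstep]), hl'⟩

end Ensures

/-! ### Permutations in lazy-initialized memory -/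

section Encoding

variable {n : ℕ}

/-- The cells `i` and `n + v` hold, as differences modulo `2 ^ w`, the values `σ i - i` and
`σ⁻¹ v - v`. So memory in which no cell has been written holds the identity. -/
def Encodes (w : ℕ) (m : ℕ → ℕ) (σ : Equiv.Perm (Fin n)) : Prop :=
  (∀ i : Fin n, (m i + i) % 2 ^ w = σ i) ∧ ∀ v : Fin n, (m (n + v) + v) % 2 ^ w = σ.symm v

theorem sub_mod_add_mod {W a b : ℕ} (ha : a < W) (hb : b < W) :
    ((a + W - b) % W + b) % W = a := by
  rw [Nat.mod_add_mod, Nat.sub_add_cancel (by omega), Nat.add_mod_right, Nat.mod_eq_of_lt ha]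

theorem encodes_zero {w : ℕ} (hn : n < 2 ^ w) :
    Encodes w (fun _ => 0) (Equiv.refl (Fin n)) := by
  constructor <;> intro i <;> simpa using Nat.mod_eq_of_lt (i.isLt.trans hn)

theorem Encodes.swap {w : ℕ} (hn : n < 2 ^ w) {m : ℕ → ℕ} {σ : Equiv.Perm (Fin n)}
    (hm : Encodes w m σ) (c p v x : Fin n) (hv : σ p = v) (hx : σ c = x) :
    Encodes w (Function.update (Function.update (Function.update (Function.update m
      c ((v + 2 ^ w - c) % 2 ^ w)) (n + v) ((c + 2 ^ w - v) % 2 ^ w))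
      p ((x + 2 ^ w - p) % 2 ^ w)) (n + x) ((p + 2 ^ w - x) % 2 ^ w))
      ((Equiv.swap c p).trans σ) := by
  have hlt : ∀ i : Fin n, (i : ℕ) < 2 ^ w := fun i => i.isLt.trans hn
  constructor
  · intro i
    have h1 : ∀ u : ℕ, (i : ℕ) ≠ n + u := fun u => by omega
    rw [Function.update_of_ne (h1 x), Equiv.trans_apply]
    by_cases hp : i = p
    · subst hp
      rw [Function.update_self, Equiv.swap_apply_right, hx]
      exact sub_mod_add_mod (hlt _) (hlt _)
    · rw [Function.update_of_ne (Fin.val_ne_of_ne hp), Function.update_of_ne (h1 v)]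
      by_cases hc : i = c
      · subst hc
        rw [Function.update_self, Equiv.swap_apply_left, hv]
        exact sub_mod_add_mod (hlt _) (hlt _)
      · rw [Function.update_of_ne (Fin.val_ne_of_ne hc), Equiv.swap_apply_of_ne_of_ne hc hp]
        exact hm.1 i
  · intro u
    have h1 : ∀ i : Fin n, n + (u : ℕ) ≠ i := fun i => by omega
    have h2 : ∀ y : Fin n, u ≠ y → n + (u : ℕ) ≠ n + y := fun y hy h =>
      hy (Fin.ext (by omega))
    rw [Equiv.symm_trans_apply, Equiv.symm_swap]
    by_cases hux : u = x
    · subst hux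
      rw [Function.update_self, ← hx, Equiv.symm_apply_apply, Equiv.swap_apply_left]
      exact sub_mod_add_mod (hlt _) (hlt _)
    · rw [Function.update_of_ne (h2 x hux), Function.update_of_ne (h1 p)]
      by_cases huv : u = v
      · subst huv
        rw [Function.update_self, ← hv, Equiv.symm_apply_apply, Equiv.swap_apply_right]
        exact sub_mod_add_mod (hlt _) (hlt _)
      · rw [Function.update_of_ne (h2 v huv), Function.update_of_ne (h1 c),
          Equiv.swap_apply_of_ne_of_ne]
        · exact hm.2 u
        · rw [Ne, Equiv.symm_apply_eq, hx]; exact hux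
        · rw [Ne, Equiv.symm_apply_eq, hv]; exact huv

end Encoding

/-! ### The program -/

/-- Row-wise enumeration for all sources from the one in register `0` up to (excluding) the one that
the instruction `ins` puts into register `2`. The registers hold: `0` the source, `1` the number of
vertices, `3` the position of the next vertex to process, `4` the number of discovered vertices,
`5` the end of the current level, `6` the current distance, `7` the current vertex, `8` its degree,
`9` the index of its next neighbour, `10` that neighbour, and `14` the constant `1`. -/
def enumerator (ins : Instr) : Program := [
  .numVerts 1,
  .add 13 1 1,
  .lazyReserve 13,
  .const 14 1,
  ins,
  -- 5: start a row by discovering the source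
  .const 3 0,
  .const 4 0,
  .const 5 1,
  .const 6 0,
  .const 8 0,
  .const 9 0,
  .move 10 0,
  .jump 29,
  -- 13: output and process the next discovered vertex
  .jumpLt 3 4 15,
  .jump 46,
  .jumpEq 3 5 17,
  .jump 19,
  .move 5 4,
  .add 6 6 14,
  .lazyLoad 7 3,
  .add 7 7 3,
  .emit 0 7 6,
  .add 3 3 14,
  .degree 8 7,
  .const 9 0,
  -- 25: scan its adjacency list
  .jumpLt 9 8 27,
  .jump 13,
  .neighbor 10 7 9,
  .add 9 9 14,
  -- 29: discover the vertex in register 10, unless this has happened already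
  .add 12 1 10,
  .lazyLoad 11 12,
  .add 11 11 10,
  .jumpLt 11 4 25,
  .lazyLoad 13 4,
  .add 13 13 4,
  .sub 15 10 4,
  .lazyStore 4 15,
  .sub 15 4 10,
  .lazyStore 12 15,
  .sub 15 13 11,
  .lazyStore 11 15,
  .add 12 1 13,
  .sub 15 11 13,
  .lazyStore 12 15,
  .add 4 4 14,
  .jump 25,
  -- 46: output the vertices that are not reachable
  .jumpLt 4 1 48,
  .jump 53,
  .lazyLoad 7 4,
  .add 7 7 4,
  .emitInf 0 7,
  .add 4 4 14,
  .jump 46,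
  -- 53: proceed to the next row
  .add 0 0 14,
  .jumpLt 0 2 5,
  .halt]

section Verification

variable {ins : Instr} {w : ℕ} {n : ℕ} {L : Fin n → List (Fin n)} {D B : ℕ}
  {G : Digraph (Fin n)} {r m : ℕ → ℕ} {σ : Equiv.Perm (Fin n)} {c b : ℕ}
  {Q : List Output → Prop}

/-- Discovering a vertex `v`: if its position `p` is not below `c`, the vertices at positions `c` and
`p` are swapped and `c` is increased. This takes at most `17` steps and outputs nothing. -/
theorem ensures_discover (hw : 4 * (n + 1) ≤ 2 ^ w) {v : Fin n} (hc : c ≤ n) (h1 : r 1 = n)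
    (h4 : r 4 = c) (h10 : r 10 = v) (h14 : r 14 = 1) (hm : Encodes w m σ)
    (H : ∀ r' m' σ' c', (∀ j ∉ [4, 11, 12, 13, 15], r' j = r j) → r' 4 = c' →
      Encodes w m' σ' → Grow σ c σ' c' {v} →
      Ensures (enumerator ins) w L D B 25 r' m' (2 * n) Q) :
    Ensures (enumerator ins) w L D (B + 17) 29 r m (2 * n) Q := by
  have hv := v.isLt
  set p : Fin n := σ.symm v with hp
  have hp' := p.isLt
  refine Ensures.add_of_lt rfl (x := n + v) (by rw [h1, h10]) (by omega) ?_
  refine Ensures.lazyLoad rfl (x := m (n + v) % 2 ^ w) (by simp; omega) (by simp) ?_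
  refine Ensures.add rfl (x := p) (by simp [h10, hm.2 v, hp]) ?_
  rcases Nat.lt_or_ge p c with hlt | hge
  · refine Ensures.jumpLt_pos rfl (by simpa [h4] using hlt) ?_
    refine (H _ m σ c ?_ ?_ hm (.of_subset hc ?_)).mono (by omega) fun _ => id
    · intro j hj
      simp only [List.mem_cons, List.not_mem_nil, not_or] at hj
      simp [hj]
    · simp [h4]
    · rintro _ rfl
      exact hlt
  · have hcn : c < n := by omega
    refine Ensures.jumpLt_neg rfl (by simpa [h4] using hge) ?_
    set x : Fin n := σ ⟨c, hcn⟩ with hx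
    have hx' := x.isLt
    refine Ensures.lazyLoad rfl (x := m c % 2 ^ w) (by simp [h4]; omega) (by simp [h4]) ?_
    refine Ensures.add rfl (x := x) (by simpa [h4] using hm.1 ⟨c, hcn⟩) ?_
    refine Ensures.sub rfl (x := (v + 2 ^ w - c) % 2 ^ w) (by simp [h4, h10]) ?_
    refine Ensures.lazyStore rfl (by simp [h4]; omega) ?_
    refine Ensures.sub rfl (x := (c + 2 ^ w - v) % 2 ^ w) (by simp [h4, h10]) ?_
    refine Ensures.lazyStore rfl (by simp; omega) ?_
    refine Ensures.sub rfl (x := (x + 2 ^ w - p) % 2 ^ w) (by simp) ?_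
    refine Ensures.lazyStore rfl (by simp; omega) ?_
    refine Ensures.add_of_lt rfl (x := n + x) (by simp [h1]) (by omega) ?_
    refine Ensures.sub rfl (x := (p + 2 ^ w - x) % 2 ^ w) (by simp) ?_
    refine Ensures.lazyStore rfl (by simp; omega) ?_
    refine Ensures.add_of_lt rfl (x := c + 1) (by simp [h4, h14]) (by omega) ?_
    refine Ensures.jump rfl ?_
    refine H _ _ ((Equiv.swap ⟨c, hcn⟩ p).trans σ) (c + 1) ?_ (by simp) ?_ (.swap hcn hge)
    · intro j hj
      simp only [List.mem_cons, List.not_mem_nil, not_or] at hj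
      simp [hj]
    · have := hm.swap (by omega) ⟨c, hcn⟩ p v x (by simp [hp]) hx.symm
      simpa [h4] using this

/-- Scanning the last `k` entries of an adjacency list discovers these `k` vertices, in at most `20`
silent steps each. -/
theorem ensures_scan (hw : 4 * (n + 1) ≤ 2 ^ w) {u : Fin n} (hL : (L u).length ≤ n) {k i : ℕ}
    (hk : i + k = (L u).length) (hc : c ≤ n) (h1 : r 1 = n) (h4 : r 4 = c) (h7 : r 7 = u)
    (h8 : r 8 = (L u).length) (h9 : r 9 = i) (h14 : r 14 = 1) (hm : Encodes w m σ)
    (H : ∀ r' m' σ' c', (∀ j ∉ [4, 9, 10, 11, 12, 13, 15], r' j = r j) → r' 4 = c' →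
      Encodes w m' σ' → Grow σ c σ' c' {v | v ∈ (L u).drop i} →
      Ensures (enumerator ins) w L D B 13 r' m' (2 * n) Q) :
    Ensures (enumerator ins) w L D (B + 2 + 20 * k) 25 r m (2 * n) Q := by
  induction k generalizing i c r m σ with
  | zero =>
    refine Ensures.jumpLt_neg rfl (by omega) ?_
    refine Ensures.jump rfl ?_
    refine H r m σ c (fun _ _ => rfl) h4 hm (.of_subset hc fun v hv => ?_)
    rw [List.drop_eq_nil_of_le (by omega)] at hv
    exact absurd hv List.not_mem_nil
  | succ k ih =>
    have hi : i < (L u).length := by omega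
    refine Ensures.jumpLt_pos rfl (by omega) ?_
    refine Ensures.neighbor rfl h7 h9 hi (by omega) ?_
    refine Ensures.add_of_lt rfl (x := i + 1) (by simp [h9, h14]) (by omega) ?_
    refine (ensures_discover (B := B + 2 + 20 * k) (v := (L u)[i]) hw hc (by simp [h1])
      (by simp [h4]) (by simp) (by simp [h14]) hm ?_)
    intro r' m' σ' c' hr' h4' hm' hg
    refine ih (i := i + 1) (by omega) hg.le_card ?_ h4' ?_ ?_ ?_ ?_ hm' ?_
    · rw [hr' 1 (by decide)]; simp [h1]
    · rw [hr' 7 (by decide)]; simp [h7]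
    · rw [hr' 8 (by decide)]; simp [h8]
    · rw [hr' 9 (by decide)]; simp
    · rw [hr' 14 (by decide)]; simp [h14]
    · intro r'' m'' σ'' c'' hr'' h4'' hm'' hg'
      refine H r'' m'' σ'' c'' (fun j hj => ?_) h4'' hm'' ?_
      · simp only [List.mem_cons, List.not_mem_nil, not_or] at hj
        rw [hr'' j (by simp [hj]), hr' j (by simp [hj])]
        simp [hj]
      · have := hg.trans hg'
        have hS : {v | v ∈ (L u).drop i} = {(L u)[i]} ∪ {v | v ∈ (L u).drop (i + 1)} := by
          ext v
          simp only [Set.mem_union, Set.mem_singleton_iff, Set.mem_ofPred_eq]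
          rw [List.drop_eq_getElem_cons hi, List.mem_cons]
        rwa [hS]

/-- The registers that do not change while the row of `s` is enumerated. -/
structure RowRegs (s : Fin n) (b : ℕ) (r : ℕ → ℕ) : Prop where
  source : r 0 = s
  card : r 1 = n
  last : r 2 = b
  one : r 14 = 1

theorem RowRegs.congr {s : Fin n} {r' : ℕ → ℕ} (hr : RowRegs s b r)
    (h : ∀ j ∈ [0, 1, 2, 14], r' j = r j) : RowRegs s b r' where
  source := (h 0 (by decide)).trans hr.source
  card := (h 1 (by decide)).trans hr.card
  last := (h 2 (by decide)).trans hr.last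
  one := (h 14 (by decide)).trans hr.one

/-- Once the search has finished, the vertices at positions `≥ i` are not reachable; they are output
with constant delay, and no time is spent on skipping the discovered ones. -/
theorem ensures_unreachable (hw : 4 * (n + 1) ≤ 2 ^ w) (hD : B + 4 ≤ D) (hB : 2 ≤ B) {s : Fin n}
    {i : ℕ} (hi : i ≤ n) (h4 : r 4 = i) (hr : RowRegs s b r) (hm : Encodes w m σ)
    (htop : ∀ v, i ≤ (σ.symm v : ℕ) → G.hopDist s v = ⊤)
    (H : ∀ r m, RowRegs s b r → Encodes w m σ →
      Ensures (enumerator ins) w L D B 53 r m (2 * n) (RowsFrom G (s + 1) b)) :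
    Ensures (enumerator ins) w L D (B + 2) 46 r m (2 * n) (RowRest G s b σ i) := by
  obtain ⟨k, hk⟩ := Nat.exists_eq_add_of_le hi
  induction k generalizing i r with
  | zero =>
    refine Ensures.jumpLt_neg rfl (by rw [hr.card]; omega) ?_
    refine Ensures.jump rfl ?_
    exact (H r m hr hm).mono le_rfl fun l hl => .of_rowsFrom (by omega) hl
  | succ k ih =>
    have hin : i < n := by omega
    obtain ⟨B, rfl⟩ := Nat.exists_eq_add_of_le' hB
    refine Ensures.jumpLt_pos rfl (by rw [hr.card]; omega) ?_
    refine Ensures.lazyLoad rfl (x := m i % 2 ^ w) (by rw [h4]; omega) (by rw [h4]) ?_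
    refine Ensures.add rfl (x := σ ⟨i, hin⟩) (by simpa [h4] using hm.1 ⟨i, hin⟩) ?_
    refine Ensures.emitInf rfl ?_
    refine Ensures.mono ?_ (show B + 2 + 2 + 2 ≤ D by omega) fun _ => id
    refine Ensures.add_of_lt rfl (x := i + 1) (by simp [h4, hr.one]) (by omega) ?_
    refine Ensures.jump rfl ?_
    refine (ih (i := i + 1) hin (by simp) (hr.congr ?_) (fun v hv => htop v (by omega))
      (by omega)).mono le_rfl fun l hl => ?_
    · simp [Function.update_apply]
    · have := hl.cons hin (htop (σ ⟨i, hin⟩) (by simp))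
      simpa [hr.source] using this

/-- The main loop of the search. If a discovered vertex is waiting, it is output within `7` steps, and
the scan of its adjacency list comes afterwards. Otherwise at most `40` silent steps lead, possibly
through the end of the row and the start of the next one, to the next output or to the halt. -/
theorem ensures_search (hw : 4 * (n + 1) ≤ 2 ^ w) (hG : G.IsAdjLists L)
    (hD : ∀ u, 20 * (L u).length + 45 ≤ D) {s : Fin n} {h e d : ℕ}
    (h3 : r 3 = h) (h4 : r 4 = c) (h5 : r 5 = e) (h6 : r 6 = d) (hr : RowRegs s b r)
    (hm : Encodes w m σ) (hI : BFSInv G s σ h c e d)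
    (H : ∀ r m (σ : Equiv.Perm (Fin n)), RowRegs s b r → Encodes w m σ →
      Ensures (enumerator ins) w L D 36 53 r m (2 * n) (RowsFrom G (s + 1) b)) :
    Ensures (enumerator ins) w L D (if h < c then 7 else 40) 13 r m (2 * n)
      (RowRest G s b σ h) := by
  obtain ⟨k, hk⟩ := Nat.exists_eq_add_of_le (hI.head_le.trans (hI.level_le.trans hI.le_card))
  induction k generalizing h c e d r m σ with
  | zero =>
    have h1 := hI.head_le
    have h2 := hI.level_le
    have hcn := hI.le_card
    rw [if_neg (by omega)]
    refine Ensures.jumpLt_neg rfl (by omega) ?_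
    refine Ensures.jump rfl ?_
    obtain rfl : c = h := by omega
    refine ensures_unreachable (B := 36) hw (by have := hD s; omega) (by omega) hcn h4 hr hm
      (fun v hv => hI.hopDist_eq_top le_rfl hv) fun r m => H r m σ
  | succ k ih =>
    have h1 := hI.head_le
    have h2 := hI.level_le
    have hcn := hI.le_card
    by_cases hhc : h < c
    swap
    · rw [if_neg hhc]
      refine Ensures.jumpLt_neg rfl (by omega) ?_
      refine Ensures.jump rfl ?_
      obtain rfl : c = h := by omega
      refine ensures_unreachable (B := 36) hw (by have := hD s; omega) (by omega) hcn h4 hr hm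
        (fun v hv => hI.hopDist_eq_top le_rfl hv) fun r m => H r m σ
    rw [if_pos hhc]
    refine Ensures.jumpLt_pos rfl (by omega) ?_
    have hhn : h < n := by omega
    have hlen : ∀ u, (L u).length ≤ n := fun u => by
      simpa using (hG u).1.length_le_card
    -- From here on, the head lies strictly inside its level.
    have main : ∀ {r : ℕ → ℕ} {e d : ℕ}, r 3 = h → r 4 = c → r 5 = e → r 6 = d →
        RowRegs s b r → BFSInv G s σ h c e d → h < e →
        Ensures (enumerator ins) w L D 3 19 r m (2 * n) (RowRest G s b σ h) := by
      intro r e d h3 h4 h5 h6 hr hI he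
      set u := σ ⟨h, hhn⟩ with hu
      have hlu := hlen u
      refine Ensures.lazyLoad rfl (x := m h % 2 ^ w) (by rw [h3]; omega) (by rw [h3]) ?_
      refine Ensures.add rfl (x := u) (by simpa [h3] using hm.1 ⟨h, hhn⟩) ?_
      refine Ensures.emit rfl ?_
      have hDu := hD u
      -- The delay after this output: three steps, the scan, and the way to the next output.
      have hB : 40 + 2 + 20 * (L u).length + 3 ≤ D := by omega
      refine Ensures.mono ?_ hB fun _ => id
      refine Ensures.add_of_lt rfl (x := h + 1) (by simp [h3, hr.one]) (by omega) ?_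
      refine Ensures.degree rfl (u := u) (by simp) (by omega) ?_
      refine Ensures.const rfl (by omega) ?_
      refine ensures_scan (u := u) (i := 0) hw hlu (by omega) hcn (by simp [hr.card])
        (by simp [h4]) (by simp) (by simp) (by simp) (by simp [hr.one]) hm ?_
      intro r' m' σ' c' hr' h4' hm' hg
      have hg' : Grow σ c σ' c' {v | G.Adj (σ ⟨h, hhn⟩) v} := by
        convert hg using 2
        simp [(hG _).2, hu]
      refine (ih (h := h + 1) ?_ h4' ?_ ?_ (hr.congr ?_) hm' (hI.process hhn he hg')
        (by omega)).mono (by split_ifs <;> omega) fun l hl => ?_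
      · rw [hr' 3 (by decide)]; simp
      · rw [hr' 5 (by decide)]; simp [h5]
      · rw [hr' 6 (by decide)]; simp [h6]
      · simp only [List.forall_mem_cons]
        refine ⟨?_, ?_, ?_, ?_, by simp⟩
        all_goals
          rw [hr' _ (by decide)]
          simp
      · have hl' := (hl.congr (hg.stable (h + 1) (by omega))).cons hhn (hI.hopDist_head hhn he)
        simpa [hr.source, h6] using hl'
    by_cases he : h = e
    · refine Ensures.jumpEq_pos rfl (by omega) ?_
      have hde := hI.dist_lt
      refine Ensures.move rfl (x := c) h4 (by omega) ?_
      refine Ensures.add_of_lt rfl (x := d + 1) (by simp [h6, hr.one]) (by omega) ?_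
      refine main (by simp [h3]) (by simp [h4]) (by simp) (by simp) (hr.congr ?_)
        (hI.nextLevel he hhc) hhc
      simp [Function.update_apply]
    · refine Ensures.jumpEq_neg rfl (by omega) ?_
      refine Ensures.jump rfl ?_
      exact (main h3 h4 h5 h6 hr hI (by omega)).mono (by omega) fun _ => id

/-- Every row starts by discovering its source. The permutation left over from the row before need
not be reset, since any permutation with no vertex discovered is a valid start. -/
theorem ensures_rows (hw : 4 * (n + 1) ≤ 2 ^ w) (hG : G.IsAdjLists L)
    (hD : ∀ u, 20 * (L u).length + 45 ≤ D) (hb : b ≤ n) {s : Fin n} (hs : s.val < b)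
    (hr : RowRegs s b r) (hm : Encodes w m σ) :
    Ensures (enumerator ins) w L D 34 5 r m (2 * n) (RowsFrom G s b) := by
  obtain ⟨k, hk⟩ := Nat.exists_eq_add_of_lt hs
  have key : ∀ {s : Fin n} {r m : ℕ → ℕ} {σ : Equiv.Perm (Fin n)}, s.val < b → RowRegs s b r →
      Encodes w m σ →
      (∀ r m (σ : Equiv.Perm (Fin n)), RowRegs s b r → Encodes w m σ →
        Ensures (enumerator ins) w L D 36 53 r m (2 * n) (RowsFrom G (s + 1) b)) →
      Ensures (enumerator ins) w L D 34 5 r m (2 * n) (RowsFrom G s b) := by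
    intro s r m σ hs hr hm H
    have hsn := s.isLt
    refine Ensures.const rfl (by omega) ?_
    refine Ensures.const rfl (by omega) ?_
    refine Ensures.const rfl (by omega) ?_
    refine Ensures.const rfl (by omega) ?_
    refine Ensures.const rfl (by omega) ?_
    refine Ensures.const rfl (by omega) ?_
    refine Ensures.move rfl (x := s) (by simp [hr.source]) (by omega) ?_
    refine Ensures.jump rfl ?_
    refine ensures_discover (B := 9) (v := s) (c := 0) hw (by omega) (by simp [hr.card])
      (by simp) (by simp) (by simp [hr.one]) hm ?_
    intro r' m' σ' c' hr' h4' hm' hg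
    refine Ensures.jumpLt_neg rfl ?_ ?_
    · rw [hr' 8 (by decide), hr' 9 (by decide)]; simp
    refine Ensures.jump rfl ?_
    have hpos : 0 < c' := (Nat.zero_le _).trans_lt ((hg.found s).2 (.inr rfl))
    have hsearch := ensures_search (r := r') (e := 1) (d := 0) hw hG hD
      (by rw [hr' 3 (by decide)]; simp) h4' (by rw [hr' 5 (by decide)]; simp)
      (by rw [hr' 6 (by decide)]; simp) (hr.congr ?_) hm' (.init hg) H
    · rw [if_pos hpos] at hsearch
      exact hsearch.mono le_rfl fun l hl => hl.rowsFrom hs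
    · simp only [List.forall_mem_cons]
      refine ⟨?_, ?_, ?_, ?_, by simp⟩
      all_goals
        rw [hr' _ (by decide)]
        simp
  induction k generalizing s r m σ with
  | zero =>
    refine key hs hr hm fun r m σ hr hm => ?_
    refine Ensures.add_of_lt rfl (x := s + 1) (by rw [hr.source, hr.one]) (by omega) ?_
    refine Ensures.jumpLt_neg rfl (by simp [hr.last]; omega) ?_
    refine Ensures.halt rfl ?_
    rw [show b = s + 1 by omega]
    exact rowsFrom_nil _
  | succ k ih =>
    refine key hs hr hm fun r m σ hr hm => ?_
    refine Ensures.add_of_lt rfl (x := s + 1) (by rw [hr.source, hr.one]) (by omega) ?_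
    refine Ensures.jumpLt_pos rfl (by simp [hr.last]; omega) ?_
    exact ih (s := ⟨s + 1, by omega⟩) (by simp only; omega)
      ⟨by simp, by simp [hr.card], by simp [hr.last], by simp [hr.one]⟩ hm (by simp only; omega)

/-- The whole program, for an instruction `ins` that, by `hins`, puts the end `b` of the range of
sources into register `2`. -/
theorem ensures_enumerator (hw : 4 * (n + 1) ≤ 2 ^ w) (hG : G.IsAdjLists L)
    (hD : ∀ u, 20 * (L u).length + 45 ≤ D) (hb : b ≤ n) {s : Fin n} (hs : s.val < b)
    (hr : r 0 = s)
    (hins : ∀ {r m : ℕ → ℕ}, r 0 = s → r 1 = n → r 14 = 1 →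
      Ensures (enumerator ins) w L D 34 5 (Function.update r 2 b) m (2 * n) (RowsFrom G s b) →
      Ensures (enumerator ins) w L D 35 4 r m (2 * n) (RowsFrom G s b)) :
    Ensures (enumerator ins) w L D 39 0 r m 0 (RowsFrom G s b) := by
  refine Ensures.numVerts rfl (by omega) ?_
  refine Ensures.add_of_lt rfl (x := 2 * n) (by simp; omega) (by omega) ?_
  refine Ensures.lazyReserve rfl (x := 2 * n) (by simp) ?_
  refine Ensures.const rfl (by omega) ?_
  refine hins (by simp [hr]) (by simp) (by simp) ?_
  exact ensures_rows hw hG hD hb hs ⟨by simp [hr], by simp, by simp, by simp⟩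
    (encodes_zero (by omega))

end Verification

/-! ### Space -/

section Space

/-- The instruction reserves no memory and does not jump to a position below `q`. -/
def Instr.IsTame (q : ℕ) : Instr → Bool
  | .jump l => q ≤ l
  | .jumpLt _ _ l => q ≤ l
  | .jumpEq _ _ l => q ≤ l
  | .reserve _ => false
  | .lazyReserve _ => false
  | _ => true

variable {P : Program} {w : ℕ} {n : ℕ} {L : Fin n → List (Fin n)} {q : ℕ} {c : Config}

theorem step_of_tame (hP : (P.drop q).all (Instr.IsTame q) = true) (hc : q ≤ c.pc) :
    q ≤ (step P w L c).pc ∧ (step P w L c).lazySize = c.lazySize ∧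
      (step P w L c).memSize = c.memSize := by
  unfold step
  split
  · rename_i ins hins
    have hmem : ins ∈ P.drop q := by
      refine List.mem_of_getElem? (i := c.pc - q) ?_
      rw [List.getElem?_drop, Nat.add_sub_cancel' hc, hins]
    have ht := List.all_eq_true.1 hP ins hmem
    cases ins <;> simp only [exec] <;> (repeat' split) <;>
      simp_all [Instr.IsTame, Config.next, Config.setReg, Config.lazyWrite_pc,
        Config.lazyWrite_lazySize, Config.lazyWrite_memSize] <;> omega
  · exact ⟨hc, rfl, rfl⟩

theorem run_of_tame (hP : (P.drop q).all (Instr.IsTame q) = true) (hc : q ≤ c.pc) (t : ℕ) :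
    (run P w L c t).lazySize = c.lazySize ∧ (run P w L c t).memSize = c.memSize := by
  induction t generalizing c with
  | zero => exact ⟨rfl, rfl⟩
  | succ t ih =>
    obtain ⟨h1, h2, h3⟩ := step_of_tame (w := w) (L := L) hP hc
    rw [run_succ]
    exact ⟨(ih h1).1.trans h2, (ih h1).2.trans h3⟩

theorem enumerator_sizes {ins : Instr} (hins : ins.IsTame 3 = true) (hw : 4 * (n + 1) ≤ 2 ^ w)
    (μ : Contents) (s : ℕ) :
    (run (enumerator ins) w L (start μ s) 3).lazySize = 2 * n ∧
      ∀ t, (run (enumerator ins) w L (start μ s) t).lazySize ≤ 2 * n ∧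
        (run (enumerator ins) w L (start μ s) t).memSize = 0 := by
  have hn : n % 2 ^ w = n := Nat.mod_eq_of_lt (by omega)
  have hn' : (n + n) % 2 ^ w = 2 * n := by rw [Nat.mod_eq_of_lt (by omega)]; omega
  have h3 : 3 ≤ (run (enumerator ins) w L (start μ s) 3).pc ∧
      (run (enumerator ins) w L (start μ s) 3).lazySize = 2 * n ∧
      (run (enumerator ins) w L (start μ s) 3).memSize = 0 := by
    simp [run, step, start, enumerator, exec, Config.next, Config.setReg, hn, hn']
  have htame : ((enumerator ins).drop 3).all (Instr.IsTame 3) = true := by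
    simp [enumerator, Instr.IsTame] at hins ⊢
    exact hins
  refine ⟨h3.2.1, fun t => ?_⟩
  rcases Nat.lt_or_ge t 3 with ht | ht
  · interval_cases t <;>
      simp [run, step, start, enumerator, exec, Config.next, Config.setReg]
  · obtain ⟨k, rfl⟩ := Nat.exists_eq_add_of_le' ht
    rw [run, Function.iterate_add_apply]
    obtain ⟨h1, h2⟩ := run_of_tame (w := w) (L := L) htame h3.1 k
    exact ⟨(h1.trans h3.2.1).le, h2.trans h3.2.2⟩

theorem enumerator_peaks {ins : Instr} (hins : ins.IsTame 3 = true) (hn : 0 < n)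
    (hw : 4 * (n + 1) ≤ 2 ^ w) (μ : Contents) (s : ℕ) :
    PeakBetween (enumerator ins) w L (start μ s) Config.lazySize 100 ∧
      PeakBetween (enumerator ins) w L (start μ s) Config.space 100 := by
  obtain ⟨h3, h⟩ := enumerator_sizes (L := L) hins hw μ s
  refine ⟨⟨⟨3, by omega⟩, fun t => ?_⟩, ⟨⟨3, ?_⟩, fun t => ?_⟩⟩
  · have := h t
    omega
  · rw [Config.space]
    omega
  · have := h t
    rw [Config.space]
    omega

end Space

/-! ### The two enumeration problems -/

theorem enumerator_spec {ins : Instr} (hins : ins.IsTame 3 = true) {w n : ℕ}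
    {G : Digraph (Fin n)} {L : Fin n → List (Fin n)} (hw : 100 * (n + 1) ≤ 2 ^ w)
    (hG : G.IsAdjLists L) {b : ℕ} (hb : b ≤ n) {s : Fin n} (hs : s.val < b)
    (h : ∀ {D : ℕ} {r m : ℕ → ℕ}, r 0 = s → r 1 = n → r 14 = 1 →
      Ensures (enumerator ins) w L D 34 5 (Function.update r 2 b) m (2 * n) (RowsFrom G s b) →
      Ensures (enumerator ins) w L D 35 4 r m (2 * n) (RowsFrom G s b))
    {Sol : List Output → Prop} (hSol : ∀ l, RowsFrom G s b l → Sol l) (μ : Contents) :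
    Enumerates (enumerator ins) w L (start μ s) Sol ∧
      DelayLE (enumerator ins) w L (start μ s) (100 * max G.maxOutDeg 1) ∧
      PeakBetween (enumerator ins) w L (start μ s) Config.lazySize 100 ∧
      PeakBetween (enumerator ins) w L (start μ s) Config.space 100 := by
  have hD : ∀ u, 20 * (L u).length + 45 ≤ 100 * max G.maxOutDeg 1 := by
    intro u
    have h1 : (L u).length ≤ G.maxOutDeg := by
      rw [← outDeg_eq_length hG]
      exact Finset.le_sup (f := G.outDeg) (Finset.mem_univ u)
    have h2 := le_max_left G.maxOutDeg 1
    have h3 := le_max_right G.maxOutDeg 1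
    omega
  obtain ⟨l, hl, hQ⟩ := ensures_enumerator (by omega) hG hD hb hs (by simp [start]) h (start μ s)
    ⟨rfl, rfl, rfl, rfl⟩
  obtain ⟨t, ht, hout⟩ := hl.exists_halted
  refine ⟨⟨t, ht, hSol _ ?_⟩, hl.delayLE ?_, enumerator_peaks hins s.pos (by omega) μ s⟩
  · rw [hout]
    exact hQ
  · have := le_max_right G.maxOutDeg 1
    omega

end WordRAM

open WordRAM in
theorem mainTheorem3 :
    -- single source shortest distances; the source is given in register 0
    (∃ (P : Program) (C : ℕ), ∀ (n : ℕ) (G : Digraph (Fin n)) (L : Fin n → List (Fin n)),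
      G.IsAdjLists L → ∀ (s : Fin n) (w : ℕ), C * (n + 1) ≤ 2 ^ w →
      ∀ μ : Contents, μ.IsWords w →
        Enumerates P w L (start μ s) (IsSSSDEnumeration G s) ∧
        DelayLE P w L (start μ s) (C * max G.maxOutDeg 1) ∧
        PeakBetween P w L (start μ s) Config.lazySize C ∧
        PeakBetween P w L (start μ s) Config.space C) ∧
    -- row-wise all pairs shortest distances
    (∃ (P : Program) (C : ℕ), ∀ (n : ℕ), 0 < n →
      ∀ (G : Digraph (Fin n)) (L : Fin n → List (Fin n)),
      G.IsAdjLists L → ∀ (w : ℕ), C * (n + 1) ≤ 2 ^ w →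
      ∀ μ : Contents, μ.IsWords w →
        Enumerates P w L (start μ 0) (IsRowWiseAPSDEnumeration G) ∧
        DelayLE P w L (start μ 0) (C * max G.maxOutDeg 1) ∧
        PeakBetween P w L (start μ 0) Config.lazySize C ∧
        PeakBetween P w L (start μ 0) Config.space C) := by
  constructor
  · refine ⟨enumerator (.add 2 0 14), 100, fun n G L hG s w hw μ _ => ?_⟩
    have hs := s.isLt
    refine enumerator_spec (b := s + 1) rfl hw hG hs (Nat.lt_succ_self _) ?_ ?_ μ
    · intro D r m h0 h1 h14
      exact Ensures.add_of_lt rfl (by rw [h0, h14]) (by omega)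
    · rintro l ⟨h1, h2, -⟩
      refine ⟨h1, fun x => (h2 x).trans ⟨?_, fun ⟨t, ht⟩ => ⟨s, t, le_rfl, Nat.lt_succ_self _, ht⟩⟩⟩
      rintro ⟨u, v, hu, hu', rfl⟩
      obtain rfl : u = s := Fin.ext (by omega)
      exact ⟨v, rfl⟩
  · refine ⟨enumerator (.move 2 1), 100, fun n hn G L hG w hw μ _ => ?_⟩
    refine enumerator_spec (b := n) (s := ⟨0, hn⟩) rfl hw hG le_rfl hn ?_ ?_ μ
    · intro D r m h0 h1 h14
      exact Ensures.move rfl h1 (by omega)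
    · rintro l ⟨h1, h2, h3⟩
      refine ⟨h1, fun x => (h2 x).trans ?_, h3⟩
      exact exists_congr fun u => exists_congr fun v => by simp
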